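/- A diffeological vector space is a real vector space with a diffeology for which addition $V\times V\to V$ and scalar multiplication $\mathbb{R}\times V\to V$ are smooth; $\mathfrak{D}\mathrm{Vect}$ is the category of diffeological vector spaces and smooth linear maps, and $L^\infty(V,W)$ is the vector space of smooth linear maps $V\to W$ with the functional diffeology. Subspaces carry the sub-diffeology and quotients the quotient diffeology. A short exact sequence $0\to A\xrightarrow{f} B\xrightarrow{g} C\to 0$ in $\mathfrak{D}\mathrm{Vect}$ is a short exact sequence of vector spaces, with $f$ and $g$ smooth linear, in which $f$ is an induction ($A$ has the diffeology pulled back along $f$) and $g$ is a subduction ($C$ has the quotient diffeology along $g$). A diffeological vector space $P$ is projective if for every linear subduction $g:A\to B$ every smooth linear map $P\to B$ lifts along $g$ to a smooth linear map $P\to A$. A sequence $A\xrightarrow{f}B\xrightarrow{g}C$ in $\mathfrak{D}\mathrm{Vect}$ is exact at $B$ in the diffeological sense if $0\to A/\ker f\to B\to \operatorname{im} g\to 0$ is a short exact sequence in $\mathfrak{D}\mathrm{Vect}$. A diffeological projective resolution of $V$ is a sequence $\cdots\to P_1\xrightarrow{d_1} P_0\xrightarrow{\varepsilon} V\to 0$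 in $\mathfrak{D}\mathrm{Vect}$ that is exact in the diffeological sense at every spot, with every $P_n$ projective. For such a resolution, $\operatorname{Ext}^n(V,W)$ is the $n$-th cohomology $H^n(L^\infty(P_\bullet,W))$, that is, cocycles (with the sub-diffeology of $L^\infty(P_n,W)$) modulo coboundaries, with the quotient diffeology. **Theorem 7.5.** Let $0\to W_1\xrightarrow{i}W_2\xrightarrow{\pi}W_3\to0$ be a short exact sequence in $\mathfrak{D}\mathrm{Vect}$ and let $V$ be a diffeological vector space. Then $V$ has a diffeological projective resolution, and for every diffeological projective resolution $P_\bullet\to V$, with $\operatorname{Ext}^n(V,-)$ computed from it, there is a sequence of diffeological vector spaces and smooth linear maps $$0\to L^\infty(V,W_1)\xrightarrow{i_*}L^\infty(V,W_2)\xrightarrow{\pi_*}L^\infty(V,W_3)\xrightarrow{\delta_0}\operatorname{Ext}^1(V,W_1)\xrightarrow{i_*}\operatorname{Ext}^1(V,W_2)\xrightarrow{\pi_*}\operatorname{Ext}^1(V,W_3)\xrightarrow{\delta_1}\operatorname{Ext}^2(V,W_1)\to\cdots$$ which is exact as a sequence of vector spaces. Here $i_*$ and $\pi_*$ are induced by composition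 with $i$ and $\pi$, and the $\delta_n$ are the usual connecting maps: for $n\ge1$, $\delta_n[c]=[a]$ whenever $c\in L^\infty(P_n,W_3)$ and $a\in L^\infty(P_{n+1},W_1)$ are cocycles and $b\in L^\infty(P_n,W_2)$ satisfies $\pi\circ b=c$ and $i\circ a=b\circ d_{n+1}$; and $\delta_0(f)=[a]$ whenever $a\in L^\infty(P_1,W_1)$ is a cocycle and $b\in L^\infty(P_0,W_2)$ satisfies $\pi\circ b=f\circ\varepsilon$ and $i\circ a=b\circ d_1$. -/

import Mathlib

open Diffeology
open scoped ContDiff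

universe u

namespace DVect

/-! ### Product, subspace and quotient diffeologies -/

section Diffeologies

variable {X Y : Type*} [DiffeologicalSpace X] [DiffeologicalSpace Y]

/-- The product diffeology: a map into `X × Y` is a plot iff both components are plots. -/
instance prodDiffeology : DiffeologicalSpace (X × Y) where
  plots n := {p | IsPlot (fun x : EuclideanSpace ℝ (Fin n) => (p x).1) ∧
    IsPlot (fun x : EuclideanSpace ℝ (Fin n) => (p x).2)}
  constant_plots _ := ⟨isPlot_const, isPlot_const⟩
  plot_reparam hp hf := ⟨isPlot_reparam hp.1 hf, isPlot_reparam hp.2 hf⟩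
  locality h :=
    ⟨DiffeologicalSpace.locality fun x =>
      let ⟨u, hu, hxu, h'⟩ := h x
      ⟨u, hu, hxu, fun hfu hf => (h' hfu hf).1⟩,
     DiffeologicalSpace.locality fun x =>
      let ⟨u, hu, hxu, h'⟩ := h x
      ⟨u, hu, hxu, fun hfu hf => (h' hfu hf).2⟩⟩

/-- The sub-diffeology: a map into a subset is a plot iff it is a plot of the ambient space. -/
instance subtypeDiffeology {s : X → Prop} : DiffeologicalSpace (Subtype s) where
  plots n := {p | IsPlot (fun x : EuclideanSpace ℝ (Fin n) => (p x).1)}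
  constant_plots _ := isPlot_const
  plot_reparam {n m p f} hp hf := isPlot_reparam (p := fun x => (p x).1) hp hf
  locality h := DiffeologicalSpace.locality fun x =>
    let ⟨u, hu, hxu, h'⟩ := h x
    ⟨u, hu, hxu, fun hfu hf => h' hfu hf⟩

/-- A map `p : ℝⁿ → Y` lifts locally along `f : X → Y` if near every point of `ℝⁿ` it is of the
form `f ∘ q` for a plot `q` of `X`. (A plot defined only on a neighbourhood of the point agrees,
on a smaller neighbourhood, with one that is defined on all of `ℝⁿ`.) -/
def LiftsLocally {X Y : Type*} [DiffeologicalSpace X] (f : X → Y) {n : ℕ}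
    (p : EuclideanSpace ℝ (Fin n) → Y) : Prop :=
  ∀ x, ∃ v : Set (EuclideanSpace ℝ (Fin n)), IsOpen v ∧ x ∈ v ∧
    ∃ q : EuclideanSpace ℝ (Fin n) → X, IsPlot q ∧ ∀ y ∈ v, f (q y) = p y

/-- Around every point of an open set `v ⊆ ℝⁿ` there is a smooth map `ℝⁿ → v` that is the identity
near that point. -/
theorem exists_smooth_retraction {n : ℕ} {v : Set (EuclideanSpace ℝ (Fin n))} (hv : IsOpen v)
    {x : EuclideanSpace ℝ (Fin n)} (hx : x ∈ v) :
    ∃ r : EuclideanSpace ℝ (Fin n) → EuclideanSpace ℝ (Fin n), ContDiff ℝ ∞ r ∧ (∀ y, r y ∈ v) ∧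
      ∃ w, IsOpen w ∧ x ∈ w ∧ ∀ y ∈ w, r y = y := by
  obtain ⟨ε, hε, hεv⟩ := Metric.isOpen_iff.mp hv x hx
  let b : ContDiffBump x := ⟨ε / 2, ε, by positivity, by linarith⟩
  refine ⟨fun y => x + b y • (y - x), ?_, fun y => hεv ?_, Metric.ball x (ε / 2),
    Metric.isOpen_ball, Metric.mem_ball_self (by positivity), fun y hy => ?_⟩
  · exact contDiff_const.add (b.contDiff.smul (contDiff_id.sub contDiff_const))
  · rw [Metric.mem_ball, dist_eq_norm, add_sub_cancel_left, norm_smul, Real.norm_eq_abs,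
      abs_of_nonneg b.nonneg]
    by_cases hy : dist y x < ε
    · rw [dist_eq_norm] at hy
      exact (mul_le_of_le_one_left (norm_nonneg _) b.le_one).trans_lt hy
    · rw [b.zero_of_le_dist (not_lt.mp hy), zero_mul]
      exact hε
  · have h1 : b y = 1 := b.one_of_mem_closedBall (Metric.ball_subset_closedBall hy)
    simp [h1]

/-- The quotient diffeology along a surjection `f`: its plots are the maps that lift locally. -/
abbrev quotientDiffeology {X Y : Type*} [DiffeologicalSpace X] (f : X → Y)
    (hf : Function.Surjective f) : DiffeologicalSpace Y where
  plots n := {p | LiftsLocally f p}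
  constant_plots y _ := by
    obtain ⟨x, rfl⟩ := hf y
    exact ⟨Set.univ, isOpen_univ, trivial, fun _ => x, isPlot_const, fun _ _ => rfl⟩
  plot_reparam {n m p g} hp hg x := by
    obtain ⟨v, hv, hxv, q, hq, h⟩ := hp (g x)
    exact ⟨g ⁻¹' v, hv.preimage hg.continuous, hxv, q ∘ g, isPlot_reparam hq hg,
      fun y hy => h _ hy⟩
  locality {n p} hp x := by
    obtain ⟨v, hv, hxv, h⟩ := hp x
    obtain ⟨r, hr, hrv, w, hw, hxw, hrw⟩ := exists_smooth_retraction hv hxv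
    obtain ⟨v', hv', hxv', q, hq, h'⟩ := h hrv hr x
    refine ⟨v' ∩ w, hv'.inter hw, ⟨hxv', hxw⟩, q, hq, fun y hy => ?_⟩
    rw [h' y hy.1, Function.comp_apply, hrw y hy.2]

/-- `f` is an induction: it is injective and the diffeology of `X` is pulled back from `Y`. -/
def IsInduction (f : X → Y) : Prop :=
  Function.Injective f ∧
    ∀ (n : ℕ) (p : EuclideanSpace ℝ (Fin n) → X), IsPlot p ↔ IsPlot (f ∘ p)

/-- `f` is a subduction: it is surjective and `Y` carries the quotient diffeology along `f`. -/
def IsSubduction (f : X → Y) : Prop :=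
  Function.Surjective f ∧
    ∀ (n : ℕ) (p : EuclideanSpace ℝ (Fin n) → Y), IsPlot p ↔ LiftsLocally f p

end Diffeologies

/-! ### Diffeological vector spaces -/

/-- A diffeological vector space: a real vector space with a diffeology for which addition and
scalar multiplication are smooth. -/
class DiffeologicalVectorSpace (V : Type*) [AddCommGroup V] [Module ℝ V] [DiffeologicalSpace V] :
    Prop where
  smooth_add : DSmooth (fun x : V × V => x.1 + x.2)
  smooth_smul : DSmooth (fun x : ℝ × V => x.1 • x.2)

section VectorSpaces

variable {V W W' : Type*}
  [AddCommGroup V] [Module ℝ V] [DiffeologicalSpace V]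
  [AddCommGroup W] [Module ℝ W] [DiffeologicalSpace W]
  [AddCommGroup W'] [Module ℝ W'] [DiffeologicalSpace W']

theorem isPlot_add [DiffeologicalVectorSpace V] {n : ℕ} {p q : EuclideanSpace ℝ (Fin n) → V}
    (hp : IsPlot p) (hq : IsPlot q) : IsPlot (fun x => p x + q x) :=
  DiffeologicalVectorSpace.smooth_add n (fun x => (p x, q x)) ⟨hp, hq⟩

theorem isPlot_smul [DiffeologicalVectorSpace V] {n : ℕ} {c : EuclideanSpace ℝ (Fin n) → ℝ}
    {q : EuclideanSpace ℝ (Fin n) → V}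
    (hc : IsPlot c) (hq : IsPlot q) : IsPlot (fun x => c x • q x) :=
  DiffeologicalVectorSpace.smooth_smul n (fun x => (c x, q x)) ⟨hc, hq⟩

/-- Linear subspaces carry the sub-diffeology. -/
instance [DiffeologicalVectorSpace V] (K : Submodule ℝ V) : DiffeologicalVectorSpace K where
  smooth_add _ _ h := isPlot_add (V := V) h.1 h.2
  smooth_smul _ _ h := isPlot_smul (V := V) h.1 h.2

/-- Quotient vector spaces carry the quotient diffeology. -/
instance (K : Submodule ℝ V) : DiffeologicalSpace (V ⧸ K) :=
  quotientDiffeology K.mkQ K.mkQ_surjective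

instance [DiffeologicalVectorSpace V] (K : Submodule ℝ V) :
    DiffeologicalVectorSpace (V ⧸ K) where
  smooth_add n p h x := by
    obtain ⟨v, hv, hxv, q, hq, e⟩ := h.1 x
    obtain ⟨v', hv', hxv', q', hq', e'⟩ := h.2 x
    refine ⟨v ∩ v', hv.inter hv', ⟨hxv, hxv'⟩, _, isPlot_add hq hq', fun y hy => ?_⟩
    rw [map_add, e y hy.1, e' y hy.2]
    rfl
  smooth_smul n p h x := by
    obtain ⟨v, hv, hxv, q, hq, e⟩ := h.2 x
    refine ⟨v, hv, hxv, _, isPlot_smul h.1 hq, fun y hy => ?_⟩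
    rw [map_smul, e y hy]
    rfl

variable (V W) in
/-- The smooth linear maps `V → W`, as a subspace of all linear maps. -/
def smoothLinearMaps [DiffeologicalVectorSpace W] : Submodule ℝ (V →ₗ[ℝ] W) where
  carrier := {f | DSmooth f}
  zero_mem' := dSmooth_const (X := V) (y := (0 : W))
  add_mem' hf hg _ _ hp := isPlot_add (hf _ _ hp) (hg _ _ hp)
  smul_mem' _ _ hf _ _ hp := isPlot_smul isPlot_const (hf _ _ hp)

variable (V W) in
/-- The vector space `L^∞(V, W)` of smooth linear maps; `f.1` is the underlying linear map. -/
def LInf [DiffeologicalVectorSpace W] : Type _ := ↥(smoothLinearMaps V W)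

instance [DiffeologicalVectorSpace W] : AddCommGroup (LInf V W) :=
  inferInstanceAs (AddCommGroup (smoothLinearMaps V W))

instance [DiffeologicalVectorSpace W] : Module ℝ (LInf V W) :=
  inferInstanceAs (Module ℝ (smoothLinearMaps V W))

/-- The functional diffeology on `L^∞(V, W)`: a map `p : ℝⁿ → L^∞(V, W)` is a plot iff
`(x, v) ↦ p x v` is a smooth map `ℝⁿ × V → W`. -/
instance [DiffeologicalVectorSpace W] : DiffeologicalSpace (LInf V W) where
  plots n := {p | DSmooth (fun z : EuclideanSpace ℝ (Fin n) × V => (p z.1).1 z.2)}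
  constant_plots f _ _ hp := f.2 _ _ hp.2
  plot_reparam {n m p g} hp hg k q hq :=
    hp k (fun x => (g (q x).1, (q x).2)) ⟨(hg.comp hq.1.contDiff).isPlot, hq.2⟩
  locality {n p} hp m q hq := DiffeologicalSpace.locality fun x => by
    obtain ⟨v, hv, hxv, h⟩ := hp (q x).1
    have hq1 : ContDiff ℝ ∞ (fun y => (q y).1) := hq.1.contDiff
    refine ⟨(fun y => (q y).1) ⁻¹' v, hv.preimage hq1.continuous, hxv, fun {k g} hgv hg => ?_⟩
    exact h (f := fun y => (q (g y)).1) hgv (hq1.comp hg) k (fun y => (y, (q (g y)).2))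
      ⟨isPlot_id, isPlot_reparam hq.2 hg⟩

instance [DiffeologicalVectorSpace W] : DiffeologicalVectorSpace (LInf V W) where
  smooth_add _ _ h _ q hq := isPlot_add (h.1 _ q hq) (h.2 _ q hq)
  smooth_smul _ _ h _ q hq := isPlot_smul
    (isPlot_reparam h.1 (IsPlot.contDiff hq.1)) (h.2 _ q hq)

/-- Composition of smooth linear maps. -/
def LInf.comp [DiffeologicalVectorSpace W] [DiffeologicalVectorSpace W']
    (g : LInf W W') (f : LInf V W) : LInf V W' :=
  ⟨g.1 ∘ₗ f.1, DSmooth.comp (f := f.1) (g := g.1) g.2 f.2⟩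

variable (V) in
/-- The map `g_* : L^∞(V, W) → L^∞(V, W')`, `f ↦ g ∘ f`. -/
def LInf.postcomp [DiffeologicalVectorSpace W] [DiffeologicalVectorSpace W'] (g : LInf W W') :
    LInf V W →ₗ[ℝ] LInf V W' where
  toFun f := g.comp f
  map_add' f f' := Subtype.ext (LinearMap.comp_add f.1 f'.1 g.1)
  map_smul' c f := Subtype.ext (LinearMap.comp_smul g.1 c f.1)

variable (W') in
/-- The map `f^* : L^∞(W, W') → L^∞(V, W')`, `g ↦ g ∘ f`. -/
def LInf.precomp [DiffeologicalVectorSpace W] [DiffeologicalVectorSpace W'] (f : LInf V W) :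
    LInf W W' →ₗ[ℝ] LInf V W' where
  toFun g := g.comp f
  map_add' g g' := Subtype.ext (LinearMap.add_comp f.1 g'.1 g.1)
  map_smul' c g := Subtype.ext (LinearMap.smul_comp c g.1 f.1)

/-- `0 → V → W → W' → 0` is a short exact sequence of diffeological vector spaces: it is a short
exact sequence of vector spaces, the first map is an induction and the second is a subduction. -/
structure IsShortExact (i : V →ₗ[ℝ] W) (p : W →ₗ[ℝ] W') : Prop where
  injective : Function.Injective i
  exact : Function.Exact i p
  surjective : Function.Surjective p
  induction : IsInduction i
  subduction : IsSubduction p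

/-- `V → W → W'` is exact at `W` in the diffeological sense: the induced sequence
`0 → V / ker f → W → im g → 0` is a short exact sequence of diffeological vector spaces. -/
def IsDExact (f : V →ₗ[ℝ] W) (g : W →ₗ[ℝ] W') : Prop :=
  IsShortExact ((LinearMap.ker f).liftQ f le_rfl) g.rangeRestrict

end VectorSpaces

/-- Projective diffeological vector spaces: smooth linear maps out of `V` lift along linear
subductions. -/
def IsProjective (V : Type u) [AddCommGroup V] [Module ℝ V] [DiffeologicalSpace V] : Prop :=
  ∀ (W₁ W₂ : Type u)
    [AddCommGroup W₁] [Module ℝ W₁] [DiffeologicalSpace W₁] [DiffeologicalVectorSpace W₁]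
    [AddCommGroup W₂] [Module ℝ W₂] [DiffeologicalSpace W₂] [DiffeologicalVectorSpace W₂]
    (f : LInf W₁ W₂), IsSubduction f.1 → ∀ g : LInf V W₂, ∃ h : LInf V W₁, f.comp h = g

/-- A diffeological projective resolution `⋯ → P 1 → P 0 → V → 0`: an exact complex of
diffeological vector spaces with every `P n` projective. Exactness at `V` says that the
augmentation is a subduction. -/
structure ProjectiveResolution (V : Type u) [AddCommGroup V] [Module ℝ V] [DiffeologicalSpace V]
    [DiffeologicalVectorSpace V] where
  /-- The terms of the resolution. -/
  X : ℕ → Type u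
  [addCommGroup : ∀ n, AddCommGroup (X n)]
  [module : ∀ n, Module ℝ (X n)]
  [diffeology : ∀ n, DiffeologicalSpace (X n)]
  [vectorSpace : ∀ n, DiffeologicalVectorSpace (X n)]
  projective : ∀ n, IsProjective (X n)
  /-- The differentials. -/
  d : ∀ n, LInf (X (n + 1)) (X n)
  /-- The augmentation. -/
  ε : LInf (X 0) V
  subduction_ε : IsSubduction ε.1
  exact_zero : IsDExact (d 0).1 ε.1
  exact_succ : ∀ n, IsDExact (d (n + 1)).1 (d n).1

attribute [instance] ProjectiveResolution.addCommGroup ProjectiveResolution.module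
  ProjectiveResolution.diffeology ProjectiveResolution.vectorSpace

/-! ### Ext -/

namespace ProjectiveResolution

variable {V : Type u} [AddCommGroup V] [Module ℝ V] [DiffeologicalSpace V]
  [DiffeologicalVectorSpace V] (P : ProjectiveResolution V)
  (W : Type u) [AddCommGroup W] [Module ℝ W] [DiffeologicalSpace W] [DiffeologicalVectorSpace W]
  {W' : Type u} [AddCommGroup W'] [Module ℝ W'] [DiffeologicalSpace W']
  [DiffeologicalVectorSpace W']

/-- The `n`-cocycles of the cochain complex `L^∞(P, W)`: the kernel of
`d^* : L^∞(P n, W) → L^∞(P (n + 1), W)`. -/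
def cocycles (n : ℕ) : Submodule ℝ (LInf (P.X n) W) :=
  LinearMap.ker (LInf.precomp W (P.d n))

/-- The `n`-coboundaries of `L^∞(P, W)`: zero for `n = 0`, and the image of
`d^* : L^∞(P (n - 1), W) → L^∞(P n, W)` for `n ≥ 1`. -/
def coboundaries : (n : ℕ) → Submodule ℝ (LInf (P.X n) W)
  | 0 => ⊥
  | n + 1 => LinearMap.range (LInf.precomp W (P.d n))

/-- `Ext^n(V, W) = H^n(L^∞(P, W))`, computed from the resolution `P` of `V`, with the quotient
diffeology of the sub-diffeology on cocycles. -/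
abbrev Ext (n : ℕ) : Type u :=
  P.cocycles W n ⧸ (P.coboundaries W n).submoduleOf (P.cocycles W n)

variable {W}

/-- The class in `Ext^n(V, W)` of a cocycle. -/
def extClass (n : ℕ) (c : P.cocycles W n) : P.Ext W n := Submodule.Quotient.mk c

theorem postcomp_mem_cocycles (g : LInf W W') (n : ℕ) (c : LInf (P.X n) W)
    (hc : c ∈ P.cocycles W n) : LInf.postcomp (P.X n) g c ∈ P.cocycles W' n := by
  have h : LInf.precomp W (P.d n) c = 0 := hc
  exact congrArg (LInf.postcomp (P.X (n + 1)) g) h |>.trans (map_zero _)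

theorem postcomp_mem_coboundaries (g : LInf W W') (n : ℕ) (c : LInf (P.X n) W)
    (hc : c ∈ P.coboundaries W n) : LInf.postcomp (P.X n) g c ∈ P.coboundaries W' n := by
  cases n with
  | zero =>
    have h : c = 0 := hc
    rw [h, map_zero]
    exact Submodule.zero_mem _
  | succ n =>
    obtain ⟨b, rfl⟩ := hc
    exact ⟨LInf.postcomp (P.X n) g b, rfl⟩

/-- The map `g_* : Ext^n(V, W) → Ext^n(V, W')`, `[c] ↦ [g ∘ c]`. -/
def extMap (g : LInf W W') (n : ℕ) : P.Ext W n →ₗ[ℝ] P.Ext W' n :=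
  Submodule.mapQ _ _
    ((LInf.postcomp (P.X n) g).restrict (P.postcomp_mem_cocycles g n))
    (fun c hc => P.postcomp_mem_coboundaries g n c.1 hc)

end ProjectiveResolution

end DVect

open DVect

namespace DVect

open scoped Manifold Topology

/-! ### Global lifting of plots along linear subductions -/

section Lifting

variable {X Y Z : Type*} [DiffeologicalSpace X] [DiffeologicalSpace Y] [DiffeologicalSpace Z]

/-! The long exact sequence is that of the cochain complexes `L^∞(P, Wₖ)`: projectivity makes π_*
surjective in every degree, and i_* is the kernel of π_* because i is an induction. The
diffeological content is the existence of enough projectives and the smoothness of the connecting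
maps. Both rest on one fact, `IsSubduction.exists_plot_lift`: along a linear subduction, plots lift
globally and not just locally, since a smooth partition of unity averages local lifts.

Global lifting makes the free space on a family of Euclidean spaces projective: lift each generating
plot and extend linearly. The free space on all plots of a space subduces onto it, and iterating
this on kernels resolves `V`.

It also shows that C^∞(ℝᵐ, -) preserves linear subductions. By transposition, a plot of `L^∞(Q, W')`
with `Q` projective then lifts along a subduction W → W' to a plot of `L^∞(Q, W)`. So a plot of
cocycles lifts to a plot of zigzags (`exists_plot_zigzag`), which makes the connecting map smooth.
In degree 0, cocycles are exactly the maps f ∘ ε, because ε is a subduction with kernel the image of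
`d 0`; this brings in `L^∞(V, -)`. -/

theorem isPlot_of_locally_eq {n : ℕ} {p : EuclideanSpace ℝ (Fin n) → X}
    (h : ∀ x, ∃ v : Set (EuclideanSpace ℝ (Fin n)), IsOpen v ∧ x ∈ v ∧
      ∃ q : EuclideanSpace ℝ (Fin n) → X, IsPlot q ∧ ∀ y ∈ v, q y = p y) : IsPlot p :=
  DiffeologicalSpace.locality fun x => by
    obtain ⟨v, hv, hxv, q, hq, e⟩ := h x
    refine ⟨v, hv, hxv, fun {m f} hf hfs => ?_⟩
    have : p ∘ f = q ∘ f := funext fun y => (e _ (hf y)).symm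
    rw [this]
    exact isPlot_reparam hq hfs

theorem IsSubduction.dSmooth {f : X → Y} (hf : IsSubduction f) : DSmooth f := fun n p hp =>
  (hf.2 n _).2 fun _ => ⟨Set.univ, isOpen_univ, trivial, p, hp, fun _ _ => rfl⟩

theorem IsInduction.dSmooth {f : X → Y} (hf : IsInduction f) : DSmooth f := fun n p hp =>
  (hf.2 n p).1 hp

/-- A map out of the target of a subduction is smooth when its pullback is. -/
theorem IsSubduction.dSmooth_of_comp {f : X → Y} (hf : IsSubduction f) {g : Y → Z}
    (h : DSmooth (g ∘ f)) : DSmooth g := fun n p hp =>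
  isPlot_of_locally_eq fun x => by
    obtain ⟨v, hv, hxv, q, hq, e⟩ := (hf.2 n p).1 hp x
    exact ⟨v, hv, hxv, _, h _ q hq, fun y hy => congrArg g (e y hy)⟩

theorem isSubduction_of_plot_lift {f : X → Y} (hs : Function.Surjective f) (hf : DSmooth f)
    (h : ∀ (n : ℕ) (p : EuclideanSpace ℝ (Fin n) → Y), IsPlot p →
      ∃ q : EuclideanSpace ℝ (Fin n) → X, IsPlot q ∧ ∀ y, f (q y) = p y) : IsSubduction f :=
  ⟨hs, fun n p => ⟨fun hp _ => by
    obtain ⟨q, hq, e⟩ := h n p hp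
    exact ⟨Set.univ, isOpen_univ, trivial, q, hq, fun y _ => e y⟩, fun hp =>
    isPlot_of_locally_eq fun x => by
      obtain ⟨v, hv, hxv, q, hq, e⟩ := hp x
      exact ⟨v, hv, hxv, _, hf _ q hq, e⟩⟩⟩

theorem isSubduction_mkQ {V : Type*} [AddCommGroup V] [Module ℝ V] [DiffeologicalSpace V]
    (K : Submodule ℝ V) : IsSubduction K.mkQ :=
  ⟨K.mkQ_surjective, fun _ _ => Iff.rfl⟩

variable {V W : Type*}
  [AddCommGroup V] [Module ℝ V] [DiffeologicalSpace V] [DiffeologicalVectorSpace V]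
  [AddCommGroup W] [Module ℝ W] [DiffeologicalSpace W]

theorem isPlot_sum {ι : Type*} {n : ℕ} (s : Finset ι) {q : ι → EuclideanSpace ℝ (Fin n) → V}
    (hq : ∀ i, IsPlot (q i)) : IsPlot (fun x => ∑ i ∈ s, q i x) := by
  classical
  induction s using Finset.induction_on with
  | empty => simpa using isPlot_const
  | insert i s hi ih => simpa [Finset.sum_insert hi] using isPlot_add (hq i) ih

/-- Plots lift globally along linear subductions: local lifts are glued with a smooth partition
of unity. -/
theorem IsSubduction.exists_plot_lift {f : V →ₗ[ℝ] W} (hf : IsSubduction f) {n : ℕ}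
    {p : EuclideanSpace ℝ (Fin n) → W} (hp : IsPlot p) :
    ∃ q : EuclideanSpace ℝ (Fin n) → V, IsPlot q ∧ ∀ y, f (q y) = p y := by
  choose v hv hxv q hq e using (hf.2 n p).1 hp
  obtain ⟨ρ, hρ⟩ := SmoothPartitionOfUnity.exists_isSubordinate
    𝓘(ℝ, EuclideanSpace ℝ (Fin n)) isClosed_univ v hv
    (fun x _ => Set.mem_iUnion.2 ⟨x, hxv x⟩)
  -- The index set `ρ.finsupport y` varies with `y`; near `x` it can be replaced by a fixed finite
  -- set, so that the sum is visibly a plot there.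
  have hsum : ∀ x y, ρ.finsupport y ⊆ ρ.fintsupport x →
      ∀ {A : Type _} [AddCommGroup A] [Module ℝ A] (φ : EuclideanSpace ℝ (Fin n) → A),
      ∑ i ∈ ρ.finsupport y, ρ i y • φ i = ∑ i ∈ ρ.fintsupport x, ρ i y • φ i := by
    intro x y h A _ _ φ
    refine Finset.sum_subset h fun i _ hi => ?_
    have : ρ i y = 0 := by simpa [ρ.mem_finsupport] using hi
    rw [this, zero_smul]
  refine ⟨fun y => ∑ i ∈ ρ.finsupport y, ρ i y • q i y, isPlot_of_locally_eq fun x => ?_,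
    fun y => ?_⟩
  · obtain ⟨u, hu, huo, hxu⟩ := eventually_nhds_iff.1 (ρ.eventually_finsupport_subset x)
    refine ⟨u, huo, hxu, fun y => ∑ i ∈ ρ.fintsupport x, ρ i y • q i y,
      isPlot_sum _ fun i => isPlot_smul ?_ (hq i), fun y hy => (hsum x y (hu y hy) _).symm⟩
    exact (ρ i).contMDiff.contDiff.isPlot
  · rw [map_sum]
    -- Only those local lifts that are valid at `y` have nonzero weight there, and the weights add
    -- up to 1.
    have : ∀ i ∈ ρ.finsupport y, f (ρ i y • q i y) = ρ i y • p y := fun i hi => by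
      have hi' : y ∈ Function.support (ρ i) := by simpa [ρ.mem_finsupport] using hi
      rw [map_smul, e i y (hρ i (subset_tsupport _ hi'))]
    rw [Finset.sum_congr rfl this, ← Finset.sum_smul, ρ.sum_finsupport y (Set.mem_univ y), one_smul]

end Lifting

/-! ### Free diffeological vector spaces -/

/-- The free vector space on the disjoint union of the Euclidean spaces of dimensions `d i`. -/
def Free {ι : Type u} (d : ι → ℕ) : Type u := (Σ i, EuclideanSpace ℝ (Fin (d i))) →₀ ℝ

namespace Free

variable {ι : Type u} (d : ι → ℕ)

noncomputable instance : AddCommGroup (Free d) :=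
  inferInstanceAs (AddCommGroup ((Σ i, EuclideanSpace ℝ (Fin (d i))) →₀ ℝ))

noncomputable instance : Module ℝ (Free d) :=
  inferInstanceAs (Module ℝ ((Σ i, EuclideanSpace ℝ (Fin (d i))) →₀ ℝ))

variable {d}

/-- The canonical plots of the free vector space. -/
noncomputable def of (i : ι) (y : EuclideanSpace ℝ (Fin (d i))) : Free d :=
  Finsupp.single ⟨i, y⟩ 1

/-- The linear extension of a family of maps on the generators. -/
noncomputable def lift {W : Type*} [AddCommGroup W] [Module ℝ W]
    (q : ∀ i, EuclideanSpace ℝ (Fin (d i)) → W) : Free d →ₗ[ℝ] W :=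
  Finsupp.linearCombination ℝ fun z : Σ i, EuclideanSpace ℝ (Fin (d i)) => q z.1 z.2

@[simp]
theorem lift_of {W : Type*} [AddCommGroup W] [Module ℝ W]
    (q : ∀ i, EuclideanSpace ℝ (Fin (d i)) → W) (i : ι) (y : EuclideanSpace ℝ (Fin (d i))) :
    lift q (of i y) = q i y :=
  (Finsupp.linearCombination_single ℝ _ _).trans (one_smul _ _)

theorem hom_ext {W : Type*} [AddCommGroup W] [Module ℝ W] {f g : Free d →ₗ[ℝ] W}
    (h : ∀ i y, f (of i y) = g (of i y)) : f = g :=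
  Finsupp.lhom_ext' fun z => LinearMap.ext_ring (h z.1 z.2)

/-- The finest vector space diffeology for which the canonical maps `of i` are plots: a map is a
plot iff its composite with every linear map that is smooth on generators is a plot. -/
instance : DiffeologicalSpace (Free d) where
  plots n := {p | ∀ (W : Type u) [AddCommGroup W] [Module ℝ W] [DiffeologicalSpace W]
    [DiffeologicalVectorSpace W] (f : Free d →ₗ[ℝ] W),
    (∀ i, IsPlot fun y => f (of i y)) → IsPlot fun x => f (p x)}
  constant_plots _ _ _ _ _ _ _ _ := isPlot_const
  plot_reparam hp hg _ _ _ _ _ f hf := isPlot_reparam (hp _ f hf) hg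
  locality h W _ _ _ _ f hf := DiffeologicalSpace.locality fun x =>
    let ⟨u, hu, hxu, h'⟩ := h x
    ⟨u, hu, hxu, fun hgu hg => h' hgu hg W f hf⟩

instance : DiffeologicalVectorSpace (Free d) where
  smooth_add _ p h W _ _ _ _ f hf := by
    have : (fun x => f (((fun z : Free d × Free d => z.1 + z.2) ∘ p) x)) =
      fun x => f (p x).1 + f (p x).2 := funext fun x => map_add f _ _
    rw [this]
    exact isPlot_add (h.1 W f hf) (h.2 W f hf)
  smooth_smul _ p h W _ _ _ _ f hf := by
    have : (fun x => f (((fun z : ℝ × Free d => z.1 • z.2) ∘ p) x)) =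
      fun x => (p x).1 • f (p x).2 := funext fun x => map_smul f _ _
    rw [this]
    exact isPlot_smul h.1 (h.2 W f hf)

theorem isPlot_of (i : ι) : IsPlot (of i : EuclideanSpace ℝ (Fin (d i)) → Free d) :=
  fun _ _ _ _ _ _ hf => hf i

theorem dSmooth_of_generators {W : Type u} [AddCommGroup W] [Module ℝ W] [DiffeologicalSpace W]
    [DiffeologicalVectorSpace W] (f : Free d →ₗ[ℝ] W) (hf : ∀ i, IsPlot fun y => f (of i y)) :
    DSmooth f := fun _ _ hp => hp W f hf

/-- The generators are linearly independent, so lifts of the generating plots may be chosen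
separately. They must be defined on all of each Euclidean space, which is why global lifting is
needed. -/
theorem isProjective : IsProjective (Free d) := by
  intro W₁ W₂ _ _ _ _ _ _ _ _ f hf g
  choose q hq e using fun i => hf.exists_plot_lift (g.2 _ _ (isPlot_of (d := d) i))
  refine ⟨⟨lift q, dSmooth_of_generators _ fun i => by simpa using hq i⟩, Subtype.ext ?_⟩
  refine hom_ext fun i y => ?_
  change f.1 (lift q (of i y)) = _
  rw [lift_of]
  exact e i y

end Free

/-- The dimensions of all plots of a diffeological space. -/
def plotDim (V : Type u) [DiffeologicalSpace V]
    (p : Σ n, {p : EuclideanSpace ℝ (Fin n) → V // IsPlot p}) : ℕ := p.1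

/-- The tautological map from the free vector space on all plots of `V` to `V`. -/
noncomputable def cover (V : Type u) [AddCommGroup V] [Module ℝ V] [DiffeologicalSpace V]
    [DiffeologicalVectorSpace V] : LInf (Free (plotDim V)) V :=
  ⟨Free.lift fun p y => p.2.1 y, Free.dSmooth_of_generators _ fun p => by
    simp only [Free.lift_of]
    exact p.2.2⟩

/-- Each plot of `V` is itself an index, and its own generator lifts it. A constant plot on ℝ⁰ gives
surjectivity. -/
theorem isSubduction_cover (V : Type u) [AddCommGroup V] [Module ℝ V] [DiffeologicalSpace V]
    [DiffeologicalVectorSpace V] : IsSubduction (cover V).1 := by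
  have key : ∀ (n : ℕ) (p : EuclideanSpace ℝ (Fin n) → V), IsPlot p →
      ∃ q : EuclideanSpace ℝ (Fin n) → Free (plotDim V), IsPlot q ∧
        ∀ y, (cover V).1 (q y) = p y := fun n p hp =>
    ⟨_, Free.isPlot_of (d := plotDim V) ⟨n, p, hp⟩, fun y => Free.lift_of _ _ _⟩
  refine isSubduction_of_plot_lift (fun v => ?_) (cover V).2 key
  obtain ⟨q, -, e⟩ := key 0 (fun _ => v) isPlot_const
  exact ⟨q 0, e 0⟩

/-! ### Existence of projective resolutions -/

section Exactness

theorem isInduction_subtype {B : Type*} [AddCommGroup B] [Module ℝ B] [DiffeologicalSpace B]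
    (K : Submodule ℝ B) : IsInduction K.subtype :=
  ⟨K.subtype_injective, fun _ _ => Iff.rfl⟩

variable {A B C D : Type*}
  [AddCommGroup A] [Module ℝ A] [DiffeologicalSpace A] [DiffeologicalVectorSpace A]
  [AddCommGroup B] [Module ℝ B] [DiffeologicalSpace B] [DiffeologicalVectorSpace B]
  [AddCommGroup C] [Module ℝ C] [DiffeologicalSpace C]
  [AddCommGroup D] [Module ℝ D] [DiffeologicalSpace D]

/-- Splicing: a linear subduction onto the kernel of `g = j ∘ e`, with `e` a subduction and `j`
an induction, gives a sequence that is exact in the diffeological sense. -/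
theorem isDExact_of_subduction_ker {e : B →ₗ[ℝ] C} (he : IsSubduction e) {j : C →ₗ[ℝ] D}
    (hj : IsInduction j) {f : A →ₗ[ℝ] LinearMap.ker e} (hf : IsSubduction f) :
    IsDExact ((LinearMap.ker e).subtype ∘ₗ f) (j ∘ₗ e) := by
  set F := (LinearMap.ker e).subtype ∘ₗ f with hF
  have hFs : DSmooth F := (isInduction_subtype _).dSmooth.comp hf.dSmooth
  have inj : Function.Injective ((LinearMap.ker F).liftQ F le_rfl) :=
    LinearMap.ker_eq_bot.1 (Submodule.ker_liftQ_eq_bot _ _ _ le_rfl)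
  have surj : Function.Surjective (j ∘ₗ e).rangeRestrict := LinearMap.surjective_rangeRestrict _
  have exact' : Function.Exact ((LinearMap.ker F).liftQ F le_rfl) (j ∘ₗ e).rangeRestrict := by
    intro b
    have h1 : (j ∘ₗ e).rangeRestrict b = 0 ↔ e b = 0 := by
      rw [← Subtype.val_inj]
      exact (map_eq_zero_iff j hj.1)
    rw [h1]
    constructor
    · intro hb
      obtain ⟨a, ha⟩ := hf.1 ⟨b, hb⟩
      exact ⟨Submodule.Quotient.mk a, congrArg Subtype.val ha⟩
    · rintro ⟨a, rfl⟩
      induction a using Submodule.Quotient.induction_on with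
      | H a => exact (f a).2
  refine ⟨inj, exact', surj, ⟨inj, fun n p => ⟨fun hp => ?_, fun hp => ?_⟩⟩, ?_⟩
  · exact (isSubduction_mkQ (LinearMap.ker F)).dSmooth_of_comp (g := (LinearMap.ker F).liftQ F le_rfl)
      hFs n p hp
  -- The image of `p` lies in `ker e`, so it lifts along `f` to a plot of `A`; by injectivity, `p`
  -- is the projection of that lift.
  · have hk : ∀ x, ((LinearMap.ker F).liftQ F le_rfl) (p x) ∈ LinearMap.ker e := by
      intro x
      obtain ⟨a, ha⟩ := Submodule.Quotient.mk_surjective _ (p x)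
      rw [← ha]
      exact (f a).2
    obtain ⟨q, hq, hqe⟩ := hf.exists_plot_lift (n := n)
      (p := fun x => ⟨((LinearMap.ker F).liftQ F le_rfl) (p x), hk x⟩) hp
    have : p = (LinearMap.ker F).mkQ ∘ q := funext fun x => inj (congrArg Subtype.val (hqe x)).symm
    rw [this]
    exact (isSubduction_mkQ _).dSmooth _ _ hq
  · refine isSubduction_of_plot_lift surj
      (fun n p hp => hj.dSmooth _ _ (he.dSmooth _ _ hp)) fun n p hp => ?_
    -- The preimages `c` are chosen pointwise and need not form a plot. However, `e ∘ c` is one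
    -- because `j` is an induction, and it is then lifted afresh along `e`.
    choose c hc using fun x => (p x).2
    have hcp : IsPlot fun x => e (c x) := (hj.2 n _).2 (by
      have : (j ∘ fun x => e (c x)) = fun x => (p x).1 := funext hc
      rw [this]
      exact hp)
    obtain ⟨q, hq, hqe⟩ := he.exists_plot_lift hcp
    exact ⟨q, hq, fun x => Subtype.ext ((congrArg j (hqe x)).trans (hc x))⟩

end Exactness

/-- A bundled diffeological vector space. -/
structure BundledDVS : Type (u + 1) where
  /-- The underlying type. -/
  carrier : Type u
  [addCommGroup : AddCommGroup carrier]
  [module : Module ℝ carrier]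
  [diffeology : DiffeologicalSpace carrier]
  [vectorSpace : DiffeologicalVectorSpace carrier]

attribute [instance] BundledDVS.addCommGroup BundledDVS.module BundledDVS.diffeology
  BundledDVS.vectorSpace

/-- The iterated syzygies of `V` with respect to the free covers. -/
noncomputable def syzygy (V : BundledDVS.{u}) : ℕ → BundledDVS.{u}
  | 0 => V
  | n + 1 => ⟨LinearMap.ker (cover (syzygy V n).carrier).1⟩

/-- The inclusion of a syzygy into the preceding free cover. -/
noncomputable def syzygyIncl (V : BundledDVS.{u}) (n : ℕ) :
    LInf (syzygy V (n + 1)).carrier (Free (plotDim (syzygy V n).carrier)) :=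
  ⟨(LinearMap.ker (cover (syzygy V n).carrier).1).subtype, (isInduction_subtype _).dSmooth⟩

theorem nonempty_projectiveResolution (V : Type u) [AddCommGroup V] [Module ℝ V]
    [DiffeologicalSpace V] [DiffeologicalVectorSpace V] : Nonempty (ProjectiveResolution V) := by
  let S := syzygy ⟨V⟩
  exact ⟨{
    X := fun n => Free (plotDim (S n).carrier)
    projective := fun n => Free.isProjective
    d := fun n => (syzygyIncl ⟨V⟩ n).comp (cover (S (n + 1)).carrier)
    ε := cover V
    subduction_ε := isSubduction_cover V
    -- The augmentation is the cover itself, with no inclusion after it, hence `j` is the identity.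
    exact_zero := isDExact_of_subduction_ker (j := LinearMap.id) (isSubduction_cover V)
      ⟨Function.injective_id, fun _ _ => Iff.rfl⟩ (isSubduction_cover (S 1).carrier)
    exact_succ := fun n => isDExact_of_subduction_ker (isSubduction_cover (S (n + 1)).carrier)
      (isInduction_subtype _) (isSubduction_cover (S (n + 2)).carrier) }⟩

/-! ### Spaces of smooth maps and the functional diffeology -/

/-- The vector space of plots `ℝᵐ → W`, as a subspace of all maps. -/
def plotSubmodule (m : ℕ) (W : Type*) [AddCommGroup W] [Module ℝ W] [DiffeologicalSpace W]
    [DiffeologicalVectorSpace W] : Submodule ℝ (EuclideanSpace ℝ (Fin m) → W) where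
  carrier := {f | IsPlot f}
  zero_mem' := isPlot_const
  add_mem' hf hg := isPlot_add hf hg
  smul_mem' _ _ hf := isPlot_smul isPlot_const hf

/-- The vector space `C^∞(ℝᵐ, W)`. -/
def PlotSpace (m : ℕ) (W : Type*) [AddCommGroup W] [Module ℝ W] [DiffeologicalSpace W]
    [DiffeologicalVectorSpace W] : Type _ := ↥(plotSubmodule m W)

namespace PlotSpace

variable {m : ℕ} {W W' : Type*}
  [AddCommGroup W] [Module ℝ W] [DiffeologicalSpace W] [DiffeologicalVectorSpace W]
  [AddCommGroup W'] [Module ℝ W'] [DiffeologicalSpace W'] [DiffeologicalVectorSpace W']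

instance : AddCommGroup (PlotSpace m W) := inferInstanceAs (AddCommGroup (plotSubmodule m W))

instance : Module ℝ (PlotSpace m W) := inferInstanceAs (Module ℝ (plotSubmodule m W))

/-- The functional diffeology on `C^∞(ℝᵐ, W)`. -/
instance : DiffeologicalSpace (PlotSpace m W) where
  plots n := {p | DSmooth (fun z : EuclideanSpace ℝ (Fin n) × EuclideanSpace ℝ (Fin m) =>
    (p z.1).1 z.2)}
  constant_plots f _ _ hp := isPlot_reparam f.2 hp.2.contDiff
  plot_reparam {n _ p g} hp hg k q hq :=
    hp k (fun x => (g (q x).1, (q x).2)) ⟨(hg.comp hq.1.contDiff).isPlot, hq.2⟩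
  locality {n p} hp k q hq := DiffeologicalSpace.locality fun x => by
    obtain ⟨v, hv, hxv, h⟩ := hp (q x).1
    have hq1 : ContDiff ℝ ∞ (fun y => (q y).1) := hq.1.contDiff
    refine ⟨(fun y => (q y).1) ⁻¹' v, hv.preimage hq1.continuous, hxv, fun {l g} hgv hg => ?_⟩
    exact h (f := fun y => (q (g y)).1) hgv (hq1.comp hg) l (fun y => (y, (q (g y)).2))
      ⟨isPlot_id, isPlot_reparam hq.2 hg⟩

instance : DiffeologicalVectorSpace (PlotSpace m W) where
  smooth_add _ _ h _ q hq := isPlot_add (h.1 _ q hq) (h.2 _ q hq)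
  smooth_smul _ _ h _ q hq := isPlot_smul
    (isPlot_reparam h.1 (IsPlot.contDiff hq.1)) (h.2 _ q hq)

variable (m) in
/-- Composition with a smooth linear map `W → W'`, as a map `C^∞(ℝᵐ, W) → C^∞(ℝᵐ, W')`. -/
def postcomp (g : LInf W W') : LInf (PlotSpace m W) (PlotSpace m W') :=
  ⟨{ toFun := fun f => ⟨fun x => g.1 (f.1 x), g.2 _ _ f.2⟩
     map_add' := fun _ _ => Subtype.ext (funext fun _ => map_add g.1 _ _)
     map_smul' := fun _ _ => Subtype.ext (funext fun _ => map_smul g.1 _ _) },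
    fun _ _ hp _ q hq => g.2 _ _ (hp _ q hq)⟩

/-- `C^∞(ℝᵐ, -)` preserves linear subductions. -/
theorem isSubduction_postcomp {g : LInf W W'} (hg : IsSubduction g.1) :
    IsSubduction (postcomp m g).1 := by
  refine isSubduction_of_plot_lift (fun f => ?_) (postcomp m g).2 fun n p hp => ?_
  · obtain ⟨q, hq, e⟩ := hg.exists_plot_lift f.2
    exact ⟨⟨q, hq⟩, Subtype.ext (funext e)⟩
  -- A plot ℝⁿ → C^∞(ℝᵐ, W') uncurries to a single plot on ℝⁿ⁺ᵐ; its global lift is curried back.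
  · let s : EuclideanSpace ℝ (Fin (n + m)) ≃L[ℝ]
        EuclideanSpace ℝ (Fin n) × EuclideanSpace ℝ (Fin m) :=
      ContinuousLinearEquiv.ofFinrankEq (by simp)
    obtain ⟨q, hq, e⟩ := hg.exists_plot_lift (p := fun x => (p (s x).1).1 (s x).2)
      (hp _ s ⟨(contDiff_fst.comp s.contDiff).isPlot, (contDiff_snd.comp s.contDiff).isPlot⟩)
    have hsm : ∀ {k : ℕ} (r : EuclideanSpace ℝ (Fin k) →
        EuclideanSpace ℝ (Fin n) × EuclideanSpace ℝ (Fin m)), IsPlot r →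
        IsPlot fun y => q (s.symm (r y)) := fun r hr =>
      isPlot_reparam hq (s.symm.contDiff.comp (hr.1.contDiff.prodMk hr.2.contDiff))
    refine ⟨fun x => ⟨fun y => q (s.symm (x, y)), hsm (fun y => (x, y)) ⟨isPlot_const, isPlot_id⟩⟩,
      fun _ r hr => hsm r hr, fun x => Subtype.ext (funext fun y => ?_)⟩
    refine (e _).trans ?_
    simp

end PlotSpace

/-! ### Functoriality of `L^∞` and factorization of smooth linear maps -/

namespace LInf

variable {U W W' W'' : Type*}
  [AddCommGroup U] [Module ℝ U] [DiffeologicalSpace U]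
  [AddCommGroup W] [Module ℝ W] [DiffeologicalSpace W] [DiffeologicalVectorSpace W]
  [AddCommGroup W'] [Module ℝ W'] [DiffeologicalSpace W'] [DiffeologicalVectorSpace W']
  [AddCommGroup W''] [Module ℝ W''] [DiffeologicalSpace W''] [DiffeologicalVectorSpace W'']

theorem ext {f g : LInf U W} (h : ∀ u, f.1 u = g.1 u) : f = g :=
  Subtype.ext (LinearMap.ext h)

theorem congr_apply {f g : LInf U W} (h : f = g) (u : U) : f.1 u = g.1 u := by rw [h]

theorem comp_zero (g : LInf W W') : g.comp (0 : LInf U W) = 0 := map_zero (postcomp U g)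

theorem zero_comp (f : LInf U W) : (0 : LInf W W').comp f = 0 := map_zero (precomp W' f)

theorem comp_sub (g : LInf W W') (f f' : LInf U W) : g.comp (f - f') = g.comp f - g.comp f' :=
  map_sub (postcomp U g) f f'

theorem sub_comp (g g' : LInf W W') (f : LInf U W) : (g - g').comp f = g.comp f - g'.comp f :=
  map_sub (precomp W' f) g g'

theorem comp_assoc (h : LInf W' W'') (g : LInf W W') (f : LInf U W) :
    (h.comp g).comp f = h.comp (g.comp f) := rfl

theorem dSmooth_postcomp (g : LInf W W') : DSmooth (postcomp U g) :=
  fun _ _ hp _ q hq => g.2 _ _ (hp _ q hq)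

theorem dSmooth_precomp (f : LInf U W) : DSmooth (precomp W' f) :=
  fun _ _ hp _ q hq => hp _ (fun x => ((q x).1, f.1 (q x).2)) ⟨hq.1, f.2 _ _ hq.2⟩

theorem comp_left_cancel {i : LInf W W'} (hi : Function.Injective i.1) {f g : LInf U W}
    (h : i.comp f = i.comp g) : f = g :=
  ext fun u => hi (congr_apply h u)

theorem comp_right_cancel {f : LInf U W} (hf : Function.Surjective f.1) {g g' : LInf W W'}
    (h : g.comp f = g'.comp f) : g = g' :=
  ext fun w => by
    obtain ⟨u, rfl⟩ := hf w
    exact congr_apply h u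

/-- `L^∞(U, -)` preserves inductions. -/
theorem isInduction_postcomp {i : LInf W W'} (hi : IsInduction i.1) :
    IsInduction (postcomp U i) :=
  ⟨fun _ _ h => comp_left_cancel hi.1 h, fun _ _ => ⟨fun hp => dSmooth_postcomp i _ _ hp,
    fun hp _ q hq => (hi.2 _ _).2 (hp _ q hq)⟩⟩

/-- Injectivity of `i` makes the pointwise preimages linear in `u`; that `i` is an induction makes
them smooth. -/
theorem exists_comp_eq_of_comp_eq_zero {i : LInf W W'} {π : LInf W' W''}
    (hex : IsShortExact i.1 π.1) {f : LInf U W'} (h : π.comp f = 0) :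
    ∃ g : LInf U W, i.comp g = f := by
  choose g hg using fun u => (hex.exact (f.1 u)).1 (congr_apply h u)
  let G : U →ₗ[ℝ] W :=
    { toFun := g
      map_add' := fun x y => hex.injective (by simp [hg])
      map_smul' := fun c x => hex.injective (by simp [hg]) }
  refine ⟨⟨G, fun n p hp => (hex.induction.2 _ _).2 ?_⟩, ext hg⟩
  have : i.1 ∘ G ∘ p = f.1 ∘ p := funext fun x => hg (p x)
  rw [this]
  exact f.2 _ _ hp

theorem comp_eq_zero_of_isShortExact {i : LInf W W'} {π : LInf W' W''}
    (hex : IsShortExact i.1 π.1) (f : LInf U W) : π.comp (i.comp f) = 0 :=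
  ext fun u => hex.exact.apply_apply_eq_zero (f.1 u)

theorem exact_postcomp {i : LInf W W'} {π : LInf W' W''} (hex : IsShortExact i.1 π.1) :
    Function.Exact (postcomp U i) (postcomp U π) := fun f => by
  constructor
  · exact fun hf => exists_comp_eq_of_comp_eq_zero hex hf
  · rintro ⟨g, rfl⟩
    exact comp_eq_zero_of_isShortExact hex g

/-- Factorization through a linear subduction. -/
theorem exists_comp_eq_of_ker_le {e : LInf U W} (he : IsSubduction e.1) {f : LInf U W'}
    (h : LinearMap.ker e.1 ≤ LinearMap.ker f.1) : ∃ g : LInf W W', g.comp e = f := by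
  -- The section `s` is only linear. Smoothness of `f ∘ s` is instead tested after composing with
  -- the subduction `e`, where it becomes `f`.
  obtain ⟨s, hs⟩ := e.1.exists_rightInverse_of_surjective (LinearMap.range_eq_top.2 he.1)
  have key : (f.1 ∘ₗ s) ∘ₗ e.1 = f.1 := LinearMap.ext fun u => by
    have : s (e.1 u) - u ∈ LinearMap.ker e.1 := by
      rw [LinearMap.mem_ker, map_sub, sub_eq_zero]
      exact LinearMap.congr_fun hs (e.1 u)
    exact sub_eq_zero.1 ((map_sub f.1 _ _).symm.trans (h this))
  refine ⟨⟨f.1 ∘ₗ s, he.dSmooth_of_comp ?_⟩, Subtype.ext key⟩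
  rw [← LinearMap.coe_comp, key]
  exact f.2

end LInf

/-- For projective `Q`, plots of `L^∞(Q, W')` lift globally along linear subductions `W → W'`. -/
theorem IsProjective.exists_plot_lift {Q W W' : Type u}
    [AddCommGroup Q] [Module ℝ Q] [DiffeologicalSpace Q]
    [AddCommGroup W] [Module ℝ W] [DiffeologicalSpace W] [DiffeologicalVectorSpace W]
    [AddCommGroup W'] [Module ℝ W'] [DiffeologicalSpace W'] [DiffeologicalVectorSpace W']
    (hQ : IsProjective Q) {π : LInf W W'} (hπ : IsSubduction π.1) {m : ℕ}
    {p : EuclideanSpace ℝ (Fin m) → LInf Q W'} (hp : IsPlot p) :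
    ∃ q : EuclideanSpace ℝ (Fin m) → LInf Q W, IsPlot q ∧ ∀ x, π.comp (q x) = p x := by
  -- Transposing turns the family of maps into one smooth linear map into C^∞(ℝᵐ, W'), to which
  -- projectivity of `Q` applies; the lift is transposed back.
  let f : LInf Q (PlotSpace m W') :=
    ⟨{ toFun := fun v => ⟨fun x => (p x).1 v, hp _ (fun x => (x, v)) ⟨isPlot_id, isPlot_const⟩⟩
       map_add' := fun v w => Subtype.ext (funext fun x => map_add (p x).1 v w)
       map_smul' := fun c v => Subtype.ext (funext fun x => map_smul (p x).1 c v) },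
      fun _ r hr _ q hq => hp _ (fun y => ((q y).2, r (q y).1))
        ⟨hq.2, isPlot_reparam hr hq.1.contDiff⟩⟩
  obtain ⟨h, hh⟩ := hQ _ _ _ (PlotSpace.isSubduction_postcomp (m := m) hπ) f
  have hsm : ∀ {k : ℕ} (r : EuclideanSpace ℝ (Fin k) → EuclideanSpace ℝ (Fin m) × Q),
      IsPlot r → IsPlot fun y => (h.1 (r y).2).1 (r y).1 := fun r hr =>
    h.2 _ _ hr.2 _ (fun y => (y, (r y).1)) ⟨isPlot_id, hr.1⟩
  refine ⟨fun x => ⟨{ toFun := fun v => (h.1 v).1 x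
                      map_add' := fun v w => by rw [map_add]; rfl
                      map_smul' := fun c v => by rw [map_smul]; rfl },
      fun _ r hr => hsm (fun y => (x, r y)) ⟨isPlot_const, hr⟩⟩,
    fun _ r hr => hsm r hr, fun x => LInf.ext fun v => ?_⟩
  exact congrFun (congrArg Subtype.val (LInf.congr_apply hh v)) x

section Exactness

variable {A B C : Type*}
  [AddCommGroup A] [Module ℝ A] [DiffeologicalSpace A]
  [AddCommGroup B] [Module ℝ B] [DiffeologicalSpace B]
  [AddCommGroup C] [Module ℝ C] [DiffeologicalSpace C]

theorem IsDExact.functionExact {f : A →ₗ[ℝ] B} {g : B →ₗ[ℝ] C} (h : IsDExact f g) :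
    Function.Exact f g := fun b => by
  have h1 : g b = 0 ↔ g.rangeRestrict b = 0 := (Subtype.val_inj (a := g.rangeRestrict b) (b := 0))
  rw [h1, h.exact b]
  constructor
  · rintro ⟨a, rfl⟩
    obtain ⟨a, rfl⟩ := Submodule.Quotient.mk_surjective _ a
    exact ⟨a, rfl⟩
  · rintro ⟨a, rfl⟩
    exact ⟨Submodule.Quotient.mk a, rfl⟩

end Exactness

/-! ### Cocycles, Ext classes and the augmentation -/

namespace ProjectiveResolution

variable {V : Type u} [AddCommGroup V] [Module ℝ V] [DiffeologicalSpace V]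
  [DiffeologicalVectorSpace V] (P : ProjectiveResolution V)
  {W : Type u} [AddCommGroup W] [Module ℝ W] [DiffeologicalSpace W] [DiffeologicalVectorSpace W]
  {W' : Type u} [AddCommGroup W'] [Module ℝ W'] [DiffeologicalSpace W']
  [DiffeologicalVectorSpace W']

theorem d_comp_d (n : ℕ) : (P.d n).comp (P.d (n + 1)) = 0 :=
  LInf.ext fun x => (P.exact_succ n).functionExact.apply_apply_eq_zero x

theorem ε_comp_d : P.ε.comp (P.d 0) = 0 :=
  LInf.ext fun x => P.exact_zero.functionExact.apply_apply_eq_zero x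

theorem mem_cocycles_iff {n : ℕ} {c : LInf (P.X n) W} :
    c ∈ P.cocycles W n ↔ c.comp (P.d n) = 0 := Iff.rfl

theorem comp_d_mem_cocycles {n : ℕ} (b : LInf (P.X n) W) :
    b.comp (P.d n) ∈ P.cocycles W (n + 1) := by
  rw [mem_cocycles_iff, LInf.comp_assoc, d_comp_d, LInf.comp_zero]

theorem extClass_surjective (n : ℕ) : Function.Surjective (P.extClass (W := W) n) :=
  Submodule.Quotient.mk_surjective _

theorem extClass_succ_eq_zero_iff {n : ℕ} {c : P.cocycles W (n + 1)} :
    P.extClass (n + 1) c = 0 ↔ ∃ b : LInf (P.X n) W, b.comp (P.d n) = c.1 :=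
  Submodule.Quotient.mk_eq_zero _

theorem isSubduction_extClass (n : ℕ) : IsSubduction (P.extClass (W := W) n) :=
  isSubduction_mkQ _

theorem extMap_extClass (g : LInf W W') (n : ℕ) (c : P.cocycles W n) :
    P.extMap g n (P.extClass n c) =
      P.extClass n ⟨g.comp c.1, P.postcomp_mem_cocycles g n c.1 c.2⟩ := rfl

theorem dSmooth_extMap (g : LInf W W') (n : ℕ) : DSmooth (P.extMap g n) :=
  (P.isSubduction_extClass n).dSmooth_of_comp <| (P.isSubduction_extClass n).dSmooth.comp
    fun _ p hp => LInf.dSmooth_postcomp g _ (fun x => (p x).1) hp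

/-- Pullback along the augmentation, as a smooth linear map `L^∞(V, W) → Z^0(L^∞(P, W))`. -/
def augment (W : Type u) [AddCommGroup W] [Module ℝ W] [DiffeologicalSpace W]
    [DiffeologicalVectorSpace W] : LInf (LInf V W) (P.cocycles W 0) :=
  ⟨(LInf.precomp W P.ε).codRestrict (P.cocycles W 0) fun f => by
      change (f.comp P.ε).comp (P.d 0) = 0
      rw [LInf.comp_assoc, ε_comp_d, LInf.comp_zero],
    fun _ p hp => LInf.dSmooth_precomp P.ε _ p hp⟩

/-- A 0-cocycle vanishes on the image of `d 0`, which is the kernel of the subduction `ε`, so it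
descends to `V`. -/
theorem exists_comp_ε_eq {c : LInf (P.X 0) W} (hc : c ∈ P.cocycles W 0) :
    ∃ f : LInf V W, f.comp P.ε = c :=
  LInf.exists_comp_eq_of_ker_le P.subduction_ε fun x hx => by
    obtain ⟨y, rfl⟩ := (P.exact_zero.functionExact x).1 hx
    exact LInf.congr_apply (P.mem_cocycles_iff.1 hc) y

/-! ### The connecting maps and the long exact sequence -/

section Connecting

variable {W₁ W₂ W₃ : Type u}
  [AddCommGroup W₁] [Module ℝ W₁] [DiffeologicalSpace W₁] [DiffeologicalVectorSpace W₁]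
  [AddCommGroup W₂] [Module ℝ W₂] [DiffeologicalSpace W₂] [DiffeologicalVectorSpace W₂]
  [AddCommGroup W₃] [Module ℝ W₃] [DiffeologicalSpace W₃] [DiffeologicalVectorSpace W₃]
  {i : LInf W₁ W₂} {π : LInf W₂ W₃}

/-- Plots of cocycles admit plots of zigzags. -/
theorem exists_plot_zigzag (hex : IsShortExact i.1 π.1) {n m : ℕ}
    {c : EuclideanSpace ℝ (Fin m) → P.cocycles W₃ n} (hc : IsPlot c) :
    ∃ (b : EuclideanSpace ℝ (Fin m) → LInf (P.X n) W₂)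
      (a : EuclideanSpace ℝ (Fin m) → P.cocycles W₁ (n + 1)), IsPlot a ∧
      ∀ x, π.comp (b x) = (c x).1 ∧ i.comp (a x).1 = (b x).comp (P.d n) := by
  obtain ⟨b, hb, hbc⟩ := (P.projective n).exists_plot_lift hex.subduction
    (p := fun x => (c x).1) hc
  have h0 : ∀ x, π.comp ((b x).comp (P.d n)) = 0 := fun x => by
    rw [← LInf.comp_assoc, hbc]
    exact (c x).2
  choose a ha using fun x => LInf.exists_comp_eq_of_comp_eq_zero hex (h0 x)
  have hac : ∀ x, a x ∈ P.cocycles W₁ (n + 1) := fun x => by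
    refine LInf.comp_left_cancel hex.injective (?_ : i.comp ((a x).comp (P.d (n + 1))) = i.comp 0)
    rw [← LInf.comp_assoc, ha, LInf.comp_zero]
    exact P.comp_d_mem_cocycles (b x)
  refine ⟨b, fun x => ⟨a x, hac x⟩, ?_, fun x => ⟨hbc x, ha x⟩⟩
  -- The maps `a x` were chosen pointwise; they form a plot because i_* is an induction and i ∘ a =
  -- b ∘ d is a plot.
  refine ((LInf.isInduction_postcomp hex.induction).2 _ a).2 ?_
  have : LInf.postcomp _ i ∘ a = LInf.precomp W₂ (P.d n) ∘ b := funext ha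
  rw [this]
  exact LInf.dSmooth_precomp _ _ _ hb

theorem exists_zigzag (hex : IsShortExact i.1 π.1) {n : ℕ} (c : P.cocycles W₃ n) :
    ∃ (b : LInf (P.X n) W₂) (a : P.cocycles W₁ (n + 1)),
      π.comp b = c.1 ∧ i.comp a.1 = b.comp (P.d n) := by
  obtain ⟨b, a, -, h⟩ := P.exists_plot_zigzag hex (m := 0) (c := fun _ => c) isPlot_const
  exact ⟨b 0, a 0, h 0⟩

/-- The connecting map on cocycles, characterized by zigzags. -/
theorem exists_connecting (hex : IsShortExact i.1 π.1) (n : ℕ) :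
    ∃ δ : LInf (P.cocycles W₃ n) (P.Ext W₁ (n + 1)),
      ∀ (c : P.cocycles W₃ n) (b : LInf (P.X n) W₂) (a : P.cocycles W₁ (n + 1)),
        π.comp b = c.1 → i.comp a.1 = b.comp (P.d n) → δ.1 c = P.extClass (n + 1) a := by
  -- `T` is the space of zigzags (b, a). The connecting map is the descent of `ψ`, (b, a) ↦ [a],
  -- along the surjection `φ`, (b, a) ↦ π ∘ b. This gives linearity and independence of choices
  -- together.
  let T : Submodule ℝ (LInf (P.X n) W₂ × P.cocycles W₁ (n + 1)) := LinearMap.eqLocus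
    (LInf.postcomp (P.X (n + 1)) i ∘ₗ (P.cocycles W₁ (n + 1)).subtype ∘ₗ LinearMap.snd ℝ _ _)
    (LInf.precomp W₂ (P.d n) ∘ₗ LinearMap.fst ℝ _ _)
  have hT : ∀ t : T, i.comp t.1.2.1 = t.1.1.comp (P.d n) := fun t => t.2
  let φ : T →ₗ[ℝ] P.cocycles W₃ n :=
    (LInf.postcomp (P.X n) π ∘ₗ LinearMap.fst ℝ _ _ ∘ₗ T.subtype).codRestrict _ fun t => by
      change (π.comp t.1.1).comp (P.d n) = 0
      rw [LInf.comp_assoc, ← hT, LInf.comp_eq_zero_of_isShortExact hex]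
  let ψ : T →ₗ[ℝ] P.Ext W₁ (n + 1) :=
    Submodule.mkQ _ ∘ₗ LinearMap.snd ℝ _ _ ∘ₗ T.subtype
  have hφ : Function.Surjective φ := fun c => by
    obtain ⟨b, a, hb, ha⟩ := P.exists_zigzag hex c
    exact ⟨⟨(b, a), ha⟩, Subtype.ext hb⟩
  have hψ : ∀ t, φ t = 0 → ψ t = 0 := fun t ht => by
    -- If π kills the middle term, that term comes from `W₁`, and `a` is the coboundary of what it
    -- comes from.
    obtain ⟨b, hb⟩ := LInf.exists_comp_eq_of_comp_eq_zero hex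
      (congrArg Subtype.val ht : π.comp t.1.1 = 0)
    refine P.extClass_succ_eq_zero_iff.2 ⟨b, LInf.comp_left_cancel hex.injective ?_⟩
    rw [← LInf.comp_assoc, hb]
    exact (hT t).symm
  obtain ⟨s, hs⟩ := φ.exists_rightInverse_of_surjective (LinearMap.range_eq_top.2 hφ)
  have key : ∀ t, ψ (s (φ t)) = ψ t := fun t => by
    rw [← sub_eq_zero, ← map_sub]
    exact hψ _ (by rw [map_sub, sub_eq_zero]; exact LinearMap.congr_fun hs (φ t))
  have hδ : ∀ (c : P.cocycles W₃ n) (b : LInf (P.X n) W₂) (a : P.cocycles W₁ (n + 1)),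
      π.comp b = c.1 → i.comp a.1 = b.comp (P.d n) → (ψ ∘ₗ s) c = P.extClass (n + 1) a :=
    fun c b a hb ha => by
      have hc : φ ⟨(b, a), ha⟩ = c := Subtype.ext hb
      rw [← hc]
      exact key _
  refine ⟨⟨ψ ∘ₗ s, fun m c hc => ?_⟩, hδ⟩
  -- The section `s` need not be smooth, but any zigzag computes the map, in particular one varying
  -- smoothly with the parameter.
  obtain ⟨b, a, ha, h⟩ := P.exists_plot_zigzag hex hc
  have : (ψ ∘ₗ s) ∘ c = P.extClass (n + 1) ∘ a :=
    funext fun x => hδ _ _ _ (h x).1 (h x).2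
  rw [this]
  exact (P.isSubduction_extClass _).dSmooth _ _ ha

/-- A coboundary c' ∘ d lifts to b ∘ d with `b` a lift of c' by projectivity. This is already a
cocycle, so its zigzag ends in a = 0. In degree 0 the only coboundary is 0. -/
theorem exists_extConnecting (hex : IsShortExact i.1 π.1) (n : ℕ) :
    ∃ δ : LInf (P.Ext W₃ n) (P.Ext W₁ (n + 1)),
      ∀ (c : P.cocycles W₃ n) (b : LInf (P.X n) W₂) (a : P.cocycles W₁ (n + 1)),
        π.comp b = c.1 → i.comp a.1 = b.comp (P.d n) →
          δ.1 (P.extClass n c) = P.extClass (n + 1) a := by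
  obtain ⟨δ, hδ⟩ := P.exists_connecting hex n
  let e : LInf (P.cocycles W₃ n) (P.Ext W₃ n) :=
    ⟨Submodule.mkQ _, (P.isSubduction_extClass n).dSmooth⟩
  obtain ⟨δ', h⟩ := LInf.exists_comp_eq_of_ker_le (e := e) (P.isSubduction_extClass n) (f := δ)
    fun c hc => by
      have hc' : P.extClass n c = 0 := hc
      have hδ0 : ∀ b : LInf (P.X n) W₂, π.comp b = c.1 → b.comp (P.d n) = 0 → δ.1 c = 0 :=
        fun b hb hb' => (hδ c b 0 hb ((LInf.comp_zero i).trans hb'.symm)).trans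
          (map_zero (Submodule.mkQ _))
      cases n with
      | zero =>
        have : c.1 = 0 := (Submodule.Quotient.mk_eq_zero _).1 hc'
        exact hδ0 0 ((LInf.comp_zero π).trans this.symm) (LInf.zero_comp _)
      | succ n =>
        obtain ⟨c', hc''⟩ := P.extClass_succ_eq_zero_iff.1 hc'
        obtain ⟨b, hb⟩ := P.projective n _ _ π hex.subduction c'
        exact hδ0 (b.comp (P.d n)) (by rw [← LInf.comp_assoc, hb, hc''])
          (P.comp_d_mem_cocycles b)
  exact ⟨δ', fun c b a hb ha => (LInf.congr_apply h c).trans (hδ c b a hb ha)⟩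

/-- If π ∘ b is a coboundary, lifting its primitive to `W₂` gives a coboundary whose subtraction
moves `b` into the image of i_* without changing its class. -/
theorem exact_extMap_extMap (hex : IsShortExact i.1 π.1) (n : ℕ) :
    Function.Exact (P.extMap i (n + 1)) (P.extMap π (n + 1)) := fun z => by
  constructor
  · intro hz
    obtain ⟨b, rfl⟩ := P.extClass_surjective _ z
    obtain ⟨c', hc'⟩ := P.extClass_succ_eq_zero_iff.1 hz
    obtain ⟨b', rfl⟩ := P.projective n _ _ π hex.subduction c'
    obtain ⟨a, ha⟩ := LInf.exists_comp_eq_of_comp_eq_zero hex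
      (f := b.1 - b'.comp (P.d n)) (by
        rw [LInf.comp_sub, sub_eq_zero, ← LInf.comp_assoc]
        exact hc'.symm)
    have hac : a ∈ P.cocycles W₁ (n + 1) := by
      refine LInf.comp_left_cancel hex.injective (?_ : i.comp (a.comp (P.d (n + 1))) = i.comp 0)
      rw [← LInf.comp_assoc, ha, LInf.comp_zero]
      exact (P.cocycles W₂ (n + 1)).sub_mem b.2 (P.comp_d_mem_cocycles b')
    refine ⟨P.extClass _ ⟨a, hac⟩, ?_⟩
    rw [extMap_extClass, ← sub_eq_zero]
    refine P.extClass_succ_eq_zero_iff.2 ⟨-b', ?_⟩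
    change -(b'.comp (P.d n)) = i.comp a - b.1
    rw [ha]
    abel
  · rintro ⟨a, rfl⟩
    obtain ⟨a, rfl⟩ := P.extClass_surjective _ a
    exact P.extClass_succ_eq_zero_iff.2
      ⟨0, (LInf.zero_comp _).trans (LInf.comp_eq_zero_of_isShortExact hex _).symm⟩

variable {n : ℕ} {δ : P.cocycles W₃ n → P.Ext W₁ (n + 1)}
  (hδ : ∀ (c : P.cocycles W₃ n) (b : LInf (P.X n) W₂) (a : P.cocycles W₁ (n + 1)),
    π.comp b = c.1 → i.comp a.1 = b.comp (P.d n) → δ c = P.extClass (n + 1) a)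

include hδ

/-- Here `δ` is any function on cocycles computed by zigzags, so the result serves both `δ₀` and the
maps on Ext. If a = a' ∘ d, then b - i ∘ a' is a cocycle that still lies over `c`. -/
theorem connecting_eq_zero_iff (hex : IsShortExact i.1 π.1) (c : P.cocycles W₃ n) :
    δ c = 0 ↔ ∃ b ∈ P.cocycles W₂ n, π.comp b = c.1 := by
  constructor
  · intro hc
    obtain ⟨b, a, hb, ha⟩ := P.exists_zigzag hex c
    rw [hδ c b a hb ha] at hc
    obtain ⟨a', ha'⟩ := P.extClass_succ_eq_zero_iff.1 hc
    refine ⟨b - i.comp a', ?_, ?_⟩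
    · rw [mem_cocycles_iff, LInf.sub_comp, LInf.comp_assoc, ha', ha, sub_self]
    · rw [LInf.comp_sub, LInf.comp_eq_zero_of_isShortExact hex, hb, sub_zero]
  · rintro ⟨b, hb, hc⟩
    exact (hδ c b 0 hc ((LInf.comp_zero i).trans hb.symm)).trans (map_zero (Submodule.mkQ _))

/-- A primitive `b` of i ∘ a is the middle of a zigzag from the cocycle π ∘ b to `a`. -/
theorem extMap_eq_zero_iff (hex : IsShortExact i.1 π.1) (z : P.Ext W₁ (n + 1)) :
    P.extMap i (n + 1) z = 0 ↔ ∃ c, δ c = z := by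
  constructor
  · intro hz
    obtain ⟨a, rfl⟩ := P.extClass_surjective _ z
    obtain ⟨b, hb⟩ := P.extClass_succ_eq_zero_iff.1 hz
    have hc : π.comp b ∈ P.cocycles W₃ n := by
      rw [mem_cocycles_iff, LInf.comp_assoc, hb]
      exact LInf.comp_eq_zero_of_isShortExact hex _
    exact ⟨⟨_, hc⟩, hδ _ b a rfl hb.symm⟩
  · rintro ⟨c, rfl⟩
    obtain ⟨b, a, hb, ha⟩ := P.exists_zigzag hex c
    rw [hδ c b a hb ha]
    exact P.extClass_succ_eq_zero_iff.2 ⟨b, ha.symm⟩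

end Connecting

end ProjectiveResolution

end DVect

theorem theorem7p5
    {W₁ W₂ W₃ V : Type u}
    [AddCommGroup W₁] [Module ℝ W₁] [DiffeologicalSpace W₁] [DiffeologicalVectorSpace W₁]
    [AddCommGroup W₂] [Module ℝ W₂] [DiffeologicalSpace W₂] [DiffeologicalVectorSpace W₂]
    [AddCommGroup W₃] [Module ℝ W₃] [DiffeologicalSpace W₃] [DiffeologicalVectorSpace W₃]
    [AddCommGroup V] [Module ℝ V] [DiffeologicalSpace V] [DiffeologicalVectorSpace V]
    (i : LInf W₁ W₂) (π : LInf W₂ W₃) (hex : IsShortExact i.1 π.1) :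
    Nonempty (ProjectiveResolution V) ∧
    ∀ P : ProjectiveResolution V,
      -- the induced maps are smooth
      DSmooth (LInf.postcomp V i) ∧ DSmooth (LInf.postcomp V π) ∧
      (∀ n, DSmooth (P.extMap i n)) ∧ (∀ n, DSmooth (P.extMap π n)) ∧
      -- the smooth connecting maps `δ₀` and `δ n`, `n ≥ 1`
      ∃ (δ₀ : LInf (LInf V W₃) (P.Ext W₁ 1)) (δ : ∀ n : ℕ, LInf (P.Ext W₃ n) (P.Ext W₁ (n + 1))),
        -- they are given by the usual zigzag
        (∀ (f : LInf V W₃) (b : LInf (P.X 0) W₂) (a : P.cocycles W₁ 1),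
          π.comp b = f.comp P.ε → i.comp a.1 = b.comp (P.d 0) →
            δ₀.1 f = P.extClass 1 a) ∧
        (∀ n, 1 ≤ n → ∀ (c : P.cocycles W₃ n) (b : LInf (P.X n) W₂) (a : P.cocycles W₁ (n + 1)),
          π.comp b = c.1 → i.comp a.1 = b.comp (P.d n) →
            (δ n).1 (P.extClass n c) = P.extClass (n + 1) a) ∧
        -- exactness as vector spaces
        Function.Injective (LInf.postcomp V i) ∧
        Function.Exact (LInf.postcomp V i) (LInf.postcomp V π) ∧
        Function.Exact (LInf.postcomp V π) δ₀.1 ∧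
        Function.Exact δ₀.1 (P.extMap i 1) ∧
        ∀ n, 1 ≤ n →
          Function.Exact (P.extMap i n) (P.extMap π n) ∧
          Function.Exact (P.extMap π n) (δ n).1 ∧
          Function.Exact (δ n).1 (P.extMap i (n + 1)) := by
  refine ⟨nonempty_projectiveResolution V, fun P => ?_⟩
  obtain ⟨δ₀, hδ₀⟩ := P.exists_connecting hex 0
  choose δ hδ using P.exists_extConnecting hex
  -- `δ₀` is the degree 0 connecting map on cocycles composed with f ↦ f ∘ ε.
  refine ⟨LInf.dSmooth_postcomp i, LInf.dSmooth_postcomp π, P.dSmooth_extMap i,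
    P.dSmooth_extMap π, δ₀.comp (P.augment W₃), δ,
    fun f b a hb ha => hδ₀ (P.augment W₃ |>.1 f) b a hb ha, fun n _ => hδ n,
    (LInf.isInduction_postcomp hex.induction).1, LInf.exact_postcomp hex,
    fun f => ?_, fun z => ?_, fun n hn => ⟨?_, fun z => ?_, fun z => ?_⟩⟩
  · refine (P.connecting_eq_zero_iff hδ₀ hex _).trans ⟨?_, ?_⟩
    · rintro ⟨b, hb, hbc⟩
      obtain ⟨g, rfl⟩ := P.exists_comp_ε_eq hb
      exact ⟨g, LInf.comp_right_cancel P.subduction_ε.1 hbc⟩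
    · rintro ⟨g, rfl⟩
      exact ⟨_, (P.augment W₂ |>.1 g).2, rfl⟩
  · refine (P.extMap_eq_zero_iff hδ₀ hex z).trans ⟨?_, ?_⟩
    · rintro ⟨c, rfl⟩
      obtain ⟨f, hf⟩ := P.exists_comp_ε_eq c.2
      exact ⟨f, congrArg δ₀.1 (Subtype.ext hf)⟩
    · rintro ⟨f, rfl⟩
      exact ⟨_, rfl⟩
  · obtain ⟨n, rfl⟩ := Nat.exists_eq_add_of_le' hn
    exact P.exact_extMap_extMap hex n
  · obtain ⟨c, rfl⟩ := P.extClass_surjective _ z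
    refine (P.connecting_eq_zero_iff (δ := fun c => (δ n).1 (P.extClass n c)) (hδ n) hex c).trans
      ⟨?_, ?_⟩
    · rintro ⟨b, hb, hbc⟩
      exact ⟨P.extClass n ⟨b, hb⟩, congrArg (P.extClass n) (Subtype.ext hbc)⟩
    · rintro ⟨b, hb⟩
      obtain ⟨b, rfl⟩ := P.extClass_surjective _ b
      obtain ⟨n, rfl⟩ := Nat.exists_eq_add_of_le' hn
      rw [P.extMap_extClass] at hb
      -- Equality of classes only gives π ∘ b - c = e ∘ d; subtracting the coboundary of a lift of
      -- `e` from `b` yields a cocycle lying exactly over `c`.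
      obtain ⟨e, he⟩ := P.extClass_succ_eq_zero_iff.1 (sub_eq_zero.2 hb :
        P.extClass (n + 1) (⟨π.comp b.1, P.postcomp_mem_cocycles π _ b.1 b.2⟩ - c) = 0)
      obtain ⟨e', rfl⟩ := P.projective n _ _ π hex.subduction e
      refine ⟨b.1 - e'.comp (P.d n),
        (P.cocycles W₂ (n + 1)).sub_mem b.2 (P.comp_d_mem_cocycles e'), ?_⟩
      rw [LInf.comp_sub, ← LInf.comp_assoc, he]
      exact sub_sub_cancel _ c.1
  · refine (P.extMap_eq_zero_iff (δ := fun c => (δ n).1 (P.extClass n c)) (hδ n) hex z).trans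
      ⟨fun ⟨c, hc⟩ => ⟨_, hc⟩, ?_⟩
    rintro ⟨c, rfl⟩
    obtain ⟨c, rfl⟩ := P.extClass_surjective _ c
    exact ⟨c, rfl⟩
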